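/- Fix an infinite set $\mathsf{Prop}$ of propositional variables and consider formulas in the language $(\wedge,\vee,\to,0,1)$. A \emph{$\Pi_2$-rule} is a triple $(\Gamma,\psi,F)$, written $\tilde\forall\bar p\,\Gamma/^2\psi$ with $F=\{\bar p\}$, where $\Gamma$ is a finite set of formulas, $\psi$ is a formula, and $F$ is a finite set of variables not occurring in $\psi$; a variable of $\Gamma$ outside $F$ is called free in $\Gamma$. If $F=\emptyset$ it is a \emph{$\Pi_1$-rule} $\Gamma/\psi$. A set $\vdash$ of $\Pi_2$-rules is a \emph{$\Pi_2$-rule system} if it satisfies the following conditions, in which all triples are required to be $\Pi_2$-rules: \begin{itemize} \item (Strong reflexivity) $\tilde\forall\bar p\,\Gamma\vdash\chi[\bar\phi/\bar p]$ whenever $\chi\in\Gamma$ and the formulas $\bar\phi$ contain no variable from $\bar p$. \item (Monotonicity) If $\tilde\forall\bar p\,\Gamma\vdash\psi$ and $\Gamma'$ is a finite set of formulas, then $\tilde\forall\bar p\,(\Gamma\cup\Gamma')\vdash\psi$. \item ($\alpha$-renaming) If $\tilde\forall\bar p\,\Gamma\vdash\psi$, then $\tilde\forall\bar q\,\Gamma[\bar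 q/\bar p]\vdash\psi$ for every tuple $\bar q$ of distinct variables none of which is free in $\Gamma$ or occurs in $\psi$. \item (Rule cut) If $\tilde\forall\bar p\,\Gamma\vdash\mu$ for each $\mu\in\Delta$ and $\tilde\forall\bar q\,\Delta\vdash\psi$, where $\Gamma$ contains no variable from $\bar q$ and $\psi$ contains no variable from $\bar p$ or $\bar q$, then $\tilde\forall\bar p\,\Gamma\vdash\psi$. \item (Bound structurality) If $\tilde\forall\bar p\,\Gamma\vdash\psi$ and $\sigma$ is a substitution that fixes every variable in $\bar p$ and is such that no variable in $\bar p$ occurs in $\sigma(\psi)$ or in $\sigma(q)$ for any $q$ free in $\Gamma$, then $\tilde\forall\bar p\,\sigma[\Gamma]\vdash\sigma(\psi)$. \end{itemize} For sets $L,\Sigma$ of $\Pi_2$-rules, let $L\oplus\Sigma$ be the smallest $\Pi_2$-rule system containing $L\cup\Sigma$. Let $\mathsf{IPC}$ be intuitionistic propositional logic, regarded as the collection of $\Pi_1$-rules consisting of the axioms of a standard Hilbert calculus and modus ponens, and let $\mathsf{LC}=\mathsf{IPC}\oplus (p\to q)\vee(q\to p)$ be the G\"odel--Dummett logic. A $\Pi_2$-rule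 $\rho$ is \emph{admissible} over $\mathsf{LC}$ if, for every formula $\chi$, $\vdash_{\mathsf{LC}\oplus\rho}\chi$ implies $\vdash_{\mathsf{LC}}\chi$. It is \emph{hereditarily admissible} over $\mathsf{LC}$ if, for every $\Pi_1$-rule $\Delta/\psi$, $\Delta\vdash_{\mathsf{LC}\oplus\rho}\psi$ implies $\Delta\vdash_{\mathsf{LC}}\psi$. \textbf{Corollary.} A $\Pi_2$-rule is admissible over $\mathsf{LC}$ if and only if it is hereditarily admissible over $\mathsf{LC}$. -/

import Mathlib

namespace PiTwo

/-- Formulas of the intuitionistic language `(∧, ∨, →, 0, 1)` over a set `α` of propositional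
variables. -/
inductive Formula (α : Type*) : Type _
  | var : α → Formula α
  | bot : Formula α
  | top : Formula α
  | and : Formula α → Formula α → Formula α
  | or : Formula α → Formula α → Formula α
  | imp : Formula α → Formula α → Formula α

namespace Formula

variable {α : Type*}

/-- The variables occurring in a formula. -/
def vars : Formula α → Set α
  | var x => {x}
  | bot => ∅
  | top => ∅
  | and φ ψ => φ.vars ∪ ψ.vars
  | or φ ψ => φ.vars ∪ ψ.vars
  | imp φ ψ => φ.vars ∪ ψ.vars

/-- Uniform (simultaneous) substitution. -/
def subst (σ : α → Formula α) : Formula α → Formula α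
  | var x => σ x
  | bot => bot
  | top => top
  | and φ ψ => and (φ.subst σ) (ψ.subst σ)
  | or φ ψ => or (φ.subst σ) (ψ.subst σ)
  | imp φ ψ => imp (φ.subst σ) (ψ.subst σ)

end Formula

/-- A `Π₂`-rule `(Γ, ψ, F)`: a finite set `Γ` of premises, a conclusion `ψ`, and a finite set `F`
of variables (the bound context) not occurring in `ψ`. -/
@[ext]
structure Rule (α : Type*) where
  premises : Set (Formula α)
  conclusion : Formula α
  bound : Set α
  finite_premises : premises.Finite
  finite_bound : bound.Finite
  bound_fresh : Disjoint bound conclusion.vars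

namespace Rule

variable {α : Type*}

/-- The variables occurring free in the premises: those outside the bound context. -/
def freeVars (r : Rule α) : Set α :=
  {x | x ∉ r.bound ∧ ∃ φ ∈ r.premises, x ∈ φ.vars}

/-- The `Π₁`-rule `Δ / ψ`: the bound context is empty. -/
def pi1 (Δ : Set (Formula α)) (hΔ : Δ.Finite) (ψ : Formula α) : Rule α where
  premises := Δ
  conclusion := ψ
  bound := ∅
  finite_premises := hΔ
  finite_bound := Set.finite_empty
  bound_fresh := Set.empty_disjoint _

/-- The rule `∅ / χ` with empty bound context; it belongs to a system iff `χ` is a theorem. -/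
def thm (χ : Formula α) : Rule α :=
  pi1 ∅ Set.finite_empty χ

end Rule

/-- `Π₂`-rule systems. In each clause the rule that has to belong to the system is a variable `r'`
whose components are prescribed; that `r'` is a rule (finiteness, and the bound variables do not
occur in the conclusion) is thus a side condition of the clause. -/
structure IsRuleSystem {α : Type*} (S : Set (Rule α)) : Prop where
  /-- `∀p̄ Γ ⊢ χ[φ̄/p̄]` for `χ ∈ Γ` and formulas `φ̄` without variables from `p̄`. -/
  strong_reflexivity : ∀ (r' : Rule α) (σ : α → Formula α), ∀ χ ∈ r'.premises,
    (∀ x ∉ r'.bound, σ x = Formula.var x) →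
    (∀ x ∈ r'.bound, Disjoint r'.bound (σ x).vars) →
    r'.conclusion = χ.subst σ →
    r' ∈ S
  /-- From `∀p̄ Γ ⊢ ψ` to `∀p̄ (Γ, Γ') ⊢ ψ`. -/
  monotonicity : ∀ r ∈ S, ∀ r' : Rule α,
    r.premises ⊆ r'.premises →
    r'.bound = r.bound →
    r'.conclusion = r.conclusion →
    r' ∈ S
  /-- From `∀p̄ Γ ⊢ ψ` to `∀q̄ Γ[q̄/p̄] ⊢ ψ`, where `q̄` is a tuple of distinct variables that do not
  occur free in `Γ` or in `ψ`; the renaming of `p̄` to `q̄` is `f`. -/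
  alpha_renaming : ∀ r ∈ S, ∀ (f : α → α) (r' : Rule α),
    (∀ x ∉ r.bound, f x = x) →
    Set.InjOn f r.bound →
    (∀ x ∈ r.bound, f x ∉ r.freeVars ∧ f x ∉ r.conclusion.vars) →
    r'.bound = f '' r.bound →
    r'.premises = Formula.subst (fun x => Formula.var (f x)) '' r.premises →
    r'.conclusion = r.conclusion →
    r' ∈ S
  /-- From `∀q̄ Δ ⊢ ψ` (the rule `r`) and `∀p̄ Γ ⊢ μ` for all `μ ∈ Δ` to `∀p̄ Γ ⊢ ψ` (the rule `r'`),
  where `Γ` contains no variable from `q̄`. -/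
  rule_cut : ∀ r ∈ S, ∀ r' : Rule α,
    (∀ μ ∈ r.premises, ∃ s ∈ S,
      s.premises = r'.premises ∧ s.bound = r'.bound ∧ s.conclusion = μ) →
    (∀ φ ∈ r'.premises, Disjoint r.bound φ.vars) →
    r'.conclusion = r.conclusion →
    r' ∈ S
  /-- From `∀p̄ Γ ⊢ ψ` to `∀p̄ σ[Γ] ⊢ σ(ψ)`, where `σ` fixes `p̄` and no variable from `p̄` occurs in
  `σ(q)` for `q` free in `Γ` (nor, `r'` being a rule, in `σ(ψ)`). -/
  bound_structurality : ∀ r ∈ S, ∀ (σ : α → Formula α) (r' : Rule α),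
    (∀ x ∈ r.bound, σ x = Formula.var x) →
    (∀ y ∈ r.freeVars, Disjoint r.bound (σ y).vars) →
    r'.bound = r.bound →
    r'.premises = Formula.subst σ '' r.premises →
    r'.conclusion = r.conclusion.subst σ →
    r' ∈ S

section

variable {α : Type*}

/-- `L ⊕ R`: the smallest `Π₂`-rule system extending `L` and containing the rules in `R`. -/
def oplus (L R : Set (Rule α)) : Set (Rule α) :=
  ⋂₀ {S | IsRuleSystem S ∧ L ⊆ S ∧ R ⊆ S}

open Formula in
/-- A standard Hilbert calculus for intuitionistic propositional logic, as a collection of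
`Π₁`-rules: the axiom schemes and modus ponens. -/
inductive IPC : Set (Rule α)
  | imp_intro (φ ψ : Formula α) : IPC (Rule.thm (imp φ (imp ψ φ)))
  | imp_distrib (φ ψ χ : Formula α) :
      IPC (Rule.thm (imp (imp φ (imp ψ χ)) (imp (imp φ ψ) (imp φ χ))))
  | and_left (φ ψ : Formula α) : IPC (Rule.thm (imp (and φ ψ) φ))
  | and_right (φ ψ : Formula α) : IPC (Rule.thm (imp (and φ ψ) ψ))
  | and_intro (φ ψ : Formula α) : IPC (Rule.thm (imp φ (imp ψ (and φ ψ))))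
  | or_inl (φ ψ : Formula α) : IPC (Rule.thm (imp φ (or φ ψ)))
  | or_inr (φ ψ : Formula α) : IPC (Rule.thm (imp ψ (or φ ψ)))
  | or_elim (φ ψ χ : Formula α) :
      IPC (Rule.thm (imp (imp φ χ) (imp (imp ψ χ) (imp (or φ ψ) χ))))
  | bot_elim (φ : Formula α) : IPC (Rule.thm (imp bot φ))
  | top_intro : IPC (Rule.thm top)
  | modus_ponens (φ ψ : Formula α) :
      IPC (Rule.pi1 {φ, imp φ ψ} (Set.toFinite _) ψ)

/-- The Gödel–Dummett logic `LC = IPC ⊕ (p → q) ∨ (q → p)`. -/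
def LC : Set (Rule α) :=
  oplus IPC {r | ∃ p q : α,
    r = Rule.thm (.or (.imp (.var p) (.var q)) (.imp (.var q) (.var p)))}

/-- `ρ` is admissible in `S`: adding `ρ` to `S` yields no new theorems. -/
def Admissible (S : Set (Rule α)) (ρ : Rule α) : Prop :=
  ∀ χ : Formula α, Rule.thm χ ∈ oplus S {ρ} → Rule.thm χ ∈ S

/-- `ρ` is hereditarily admissible in `S`: adding `ρ` to `S` yields no new `Π₁`-rules. -/
def HereditarilyAdmissible (S : Set (Rule α)) (ρ : Rule α) : Prop :=
  ∀ (Δ : Set (Formula α)) (hΔ : Δ.Finite) (ψ : Formula α),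
    Rule.pi1 Δ hΔ ψ ∈ oplus S {ρ} → Rule.pi1 Δ hΔ ψ ∈ S

end

end PiTwo

/-!
Over a Gödel–Dummett logic every classically satisfiable formula `φ` has a projective unifier: if
`v` is a two-valued model of `φ`, let `σ x` be `φ → x` when `v` makes `x` true and `¬¬φ ∧ (φ → x)`
otherwise. Given `φ`, each `σ x` is equivalent to `x`. To see that `σ φ` is a theorem, split on the
weak excluded middle `¬φ ∨ ¬¬φ`, which follows from linearity: under `¬φ` each `σ x` takes the truth
value of `x` under `v`, so `σ φ` is true by Kalmár's lemma; under `¬¬φ` each `σ x` is equivalent to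
`φ → x`, and as `φ → _` commutes with all connectives (with `∨` by linearity, with `0` by `¬¬φ`),
`σ φ` is equivalent to `φ → φ`. An unsatisfiable `φ` is refutable by Glivenko's theorem; the case
distinctions on variables in its proof are intuitionistically valid because the goal is a negation.

Hence the logic is structurally complete: if every substitution making `φ` a theorem also makes `ψ`
a theorem, then `σ ψ` is a theorem for the projective unifier `σ` of `φ`, and `φ` entails `σ ψ → ψ`.
When `Δ / ψ` becomes derivable after adding an admissible rule, all its substitution instances
preserve theoremhood, so that it was derivable before.
-/

namespace PiTwo

variable {α : Type*}

namespace Formula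

/-- Negation `¬φ`, encoded as `φ → 0`. -/
abbrev neg (φ : Formula α) : Formula α := imp φ bot

/-- Classical truth under a two-valued valuation. -/
def Holds (v : α → Prop) : Formula α → Prop
  | var x => v x
  | bot => False
  | top => True
  | and φ ψ => φ.Holds v ∧ ψ.Holds v
  | or φ ψ => φ.Holds v ∨ ψ.Holds v
  | imp φ ψ => φ.Holds v → ψ.Holds v

theorem finite_vars (φ : Formula α) : φ.vars.Finite := by
  induction φ <;> simp_all [vars]

theorem subst_var (φ : Formula α) : φ.subst var = φ := by
  induction φ <;> simp_all [subst]

end Formula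

open Formula

/-- The theorems of a set of rules. -/
def theorems (S : Set (Rule α)) : Set (Formula α) := {χ | Rule.thm χ ∈ S}

theorem isRuleSystem_oplus (L R : Set (Rule α)) : IsRuleSystem (oplus L R) where
  strong_reflexivity r' σ χ hχ hσ hdisj hconcl _ hS :=
    hS.1.strong_reflexivity r' σ χ hχ hσ hdisj hconcl
  monotonicity r hr r' hprem hbound hconcl S hS :=
    hS.1.monotonicity r (hr S hS) r' hprem hbound hconcl
  alpha_renaming r hr f r' hf hinj hfresh hbound hprem hconcl S hS :=
    hS.1.alpha_renaming r (hr S hS) f r' hf hinj hfresh hbound hprem hconcl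
  rule_cut r hr r' hcut hdisj hconcl S hS :=
    hS.1.rule_cut r (hr S hS) r' (fun μ hμ => (hcut μ hμ).imp fun _ hs => ⟨hs.1 S hS, hs.2⟩)
      hdisj hconcl
  bound_structurality r hr σ r' hσ hdisj hbound hprem hconcl S hS :=
    hS.1.bound_structurality r (hr S hS) σ r' hσ hdisj hbound hprem hconcl

theorem subset_oplus_left (L R : Set (Rule α)) : L ⊆ oplus L R :=
  fun _ hr _ hS => hS.2.1 hr

theorem subset_oplus_right (L R : Set (Rule α)) : R ⊆ oplus L R :=
  fun _ hr _ hS => hS.2.2 hr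

theorem IPC_subset_LC : (IPC : Set (Rule α)) ⊆ LC :=
  subset_oplus_left _ _

namespace IsRuleSystem

variable {S : Set (Rule α)} {Γ Δ : Set (Formula α)} {φ χ : Formula α}

theorem pi1_mem_of_mem (hS : IsRuleSystem S) (hΔ : Δ.Finite) (hχ : χ ∈ Δ) :
    Rule.pi1 Δ hΔ χ ∈ S :=
  hS.strong_reflexivity _ var χ hχ (fun _ _ => rfl) (fun _ h => h.elim) χ.subst_var.symm

theorem pi1_mem_of_thm_mem (hS : IsRuleSystem S) (hΔ : Δ.Finite) (h : Rule.thm χ ∈ S) :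
    Rule.pi1 Δ hΔ χ ∈ S :=
  hS.monotonicity _ h _ (Set.empty_subset _) rfl rfl

theorem pi1_cut (hS : IsRuleSystem S) (hΓ : Γ.Finite) {hΔ : Δ.Finite}
    (h : Rule.pi1 Δ hΔ χ ∈ S) (hcut : ∀ μ ∈ Δ, Rule.pi1 Γ hΓ μ ∈ S) : Rule.pi1 Γ hΓ χ ∈ S :=
  hS.rule_cut _ h _ (fun μ hμ => ⟨_, hcut μ hμ, rfl, rfl, rfl⟩)
    (fun _ _ => Set.empty_disjoint _) rfl

theorem pi1_subst (hS : IsRuleSystem S) {hΔ : Δ.Finite} (h : Rule.pi1 Δ hΔ χ ∈ S)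
    (σ : α → Formula α) : Rule.pi1 (subst σ '' Δ) (hΔ.image _) (χ.subst σ) ∈ S :=
  hS.bound_structurality _ h σ _ (fun _ h => h.elim) (fun _ _ => Set.empty_disjoint _) rfl rfl rfl

theorem thm_subst_mem (hS : IsRuleSystem S) {hΔ : Δ.Finite} (h : Rule.pi1 Δ hΔ χ ∈ S)
    {σ : α → Formula α} (hσ : ∀ δ ∈ Δ, Rule.thm (δ.subst σ) ∈ S) : Rule.thm (χ.subst σ) ∈ S :=
  hS.pi1_cut Set.finite_empty (hS.pi1_subst h σ) (Set.forall_mem_image.2 hσ)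

theorem pi1_modus_ponens (hS : IsRuleSystem S) (hIPC : IPC ⊆ S) {hΔ : Δ.Finite}
    (himp : Rule.pi1 Δ hΔ (imp φ χ) ∈ S) (hφ : Rule.pi1 Δ hΔ φ ∈ S) : Rule.pi1 Δ hΔ χ ∈ S := by
  refine hS.pi1_cut hΔ (hIPC (IPC.modus_ponens φ χ)) ?_
  rintro μ (rfl | rfl)
  · exact hφ
  · exact himp

theorem thm_linearity_mem [Nontrivial α] (hS : IsRuleSystem S) (hLC : LC ⊆ S) (φ ψ : Formula α) :
    Rule.thm (or (imp φ ψ) (imp ψ φ)) ∈ S := by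
  classical
  obtain ⟨p, q, hpq⟩ := exists_pair_ne α
  have hax : Rule.thm (or (imp (var p) (var q)) (imp (var q) (var p))) ∈ S :=
    hLC (subset_oplus_right _ _ ⟨p, q, rfl⟩)
  have hinst := hS.thm_subst_mem hax (σ := fun x => if x = p then φ else ψ) fun _ h => h.elim
  simpa only [subst, if_true, if_neg hpq.symm] using hinst

end IsRuleSystem

/-- Derivability from a set of hypotheses in the Hilbert calculus for intuitionistic logic. Logics
extending it are treated by counting their theorems among the hypotheses. -/
inductive Derives (Γ : Set (Formula α)) : Formula α → Prop
  | hyp {φ : Formula α} : φ ∈ Γ → Derives Γ φ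
  | ax {φ : Formula α} : Rule.thm φ ∈ IPC → Derives Γ φ
  | mp {φ ψ : Formula α} : Derives Γ (imp φ ψ) → Derives Γ φ → Derives Γ ψ

infix:50 " ⊢ᵢ " => Derives

namespace Derives

variable {Γ Γ' Δ : Set (Formula α)} {φ ψ χ : Formula α}

theorem pi1_mem {S : Set (Rule α)} (hS : IsRuleSystem S) (hIPC : IPC ⊆ S) (hΔ : Δ.Finite)
    (h : Δ ∪ theorems S ⊢ᵢ φ) : Rule.pi1 Δ hΔ φ ∈ S := by
  induction h with
  | hyp h => exact h.elim (hS.pi1_mem_of_mem hΔ) (hS.pi1_mem_of_thm_mem hΔ)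
  | ax h => exact hS.pi1_mem_of_thm_mem hΔ (hIPC h)
  | mp _ _ ihimp ih => exact hS.pi1_modus_ponens hIPC ihimp ih

theorem mono (h : Γ ⊢ᵢ φ) (hΓ : Γ ⊆ Γ') : Γ' ⊢ᵢ φ := by
  induction h with
  | hyp h => exact hyp (hΓ h)
  | ax h => exact ax h
  | mp _ _ ihimp ih => exact mp ihimp ih

theorem weaken (h : Γ ⊢ᵢ φ) : insert χ Γ ⊢ᵢ φ := h.mono (Set.subset_insert _ _)

theorem head : insert φ Γ ⊢ᵢ φ := hyp (Set.mem_insert _ _)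

theorem const (h : Γ ⊢ᵢ ψ) : Γ ⊢ᵢ imp φ ψ := mp (ax (IPC.imp_intro ψ φ)) h

theorem imp_self : Γ ⊢ᵢ imp φ φ :=
  mp (mp (ax (IPC.imp_distrib φ (imp φ φ) φ)) (ax (IPC.imp_intro φ (imp φ φ))))
    (ax (IPC.imp_intro φ φ))

theorem deduction (h : insert φ Γ ⊢ᵢ ψ) : Γ ⊢ᵢ imp φ ψ := by
  induction h with
  | hyp h =>
    rcases h with rfl | h
    · exact imp_self
    · exact const (hyp h)
  | ax h => exact const (ax h)
  | mp _ _ ihimp ih => exact mp (mp (ax (IPC.imp_distrib _ _ _)) ihimp) ih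

theorem cut (h : Γ ⊢ᵢ φ) (h' : insert φ Γ ⊢ᵢ ψ) : Γ ⊢ᵢ ψ := h'.deduction.mp h

theorem top_intro : Γ ⊢ᵢ top := ax IPC.top_intro

theorem bot_elim (h : Γ ⊢ᵢ bot) : Γ ⊢ᵢ φ := mp (ax (IPC.bot_elim φ)) h

theorem and_intro (h : Γ ⊢ᵢ φ) (h' : Γ ⊢ᵢ ψ) : Γ ⊢ᵢ and φ ψ :=
  mp (mp (ax (IPC.and_intro φ ψ)) h) h'

theorem and_left (h : Γ ⊢ᵢ and φ ψ) : Γ ⊢ᵢ φ := mp (ax (IPC.and_left φ ψ)) h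

theorem and_right (h : Γ ⊢ᵢ and φ ψ) : Γ ⊢ᵢ ψ := mp (ax (IPC.and_right φ ψ)) h

theorem or_inl (h : Γ ⊢ᵢ φ) : Γ ⊢ᵢ or φ ψ := mp (ax (IPC.or_inl φ ψ)) h

theorem or_inr (h : Γ ⊢ᵢ ψ) : Γ ⊢ᵢ or φ ψ := mp (ax (IPC.or_inr φ ψ)) h

theorem or_elim (h : Γ ⊢ᵢ or φ ψ) (hφ : insert φ Γ ⊢ᵢ χ) (hψ : insert ψ Γ ⊢ᵢ χ) : Γ ⊢ᵢ χ :=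
  mp (mp (mp (ax (IPC.or_elim φ ψ χ)) hφ.deduction) hψ.deduction) h

theorem neg_by_cases (ψ : Formula α) (hψ : insert ψ Γ ⊢ᵢ φ.neg) (hnψ : insert ψ.neg Γ ⊢ᵢ φ.neg) :
    Γ ⊢ᵢ φ.neg := by
  have hcontra : insert φ Γ ⊢ᵢ ψ.neg :=
    deduction (mp (mp hψ.deduction.weaken.weaken head) head.weaken)
  exact deduction (mp (mp hnψ.deduction.weaken hcontra) head)

theorem exists_conjunction (hΔ : Δ.Finite) : ∃ φ, Δ ⊢ᵢ φ ∧ ∀ δ ∈ Δ, {φ} ⊢ᵢ δ := by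
  induction Δ, hΔ using Set.Finite.induction_on with
  | empty => exact ⟨top, top_intro, fun _ h => h.elim⟩
  | @insert δ Δ _ _ ih =>
    obtain ⟨φ, hΔφ, hφΔ⟩ := ih
    refine ⟨and δ φ, and_intro head hΔφ.weaken, Set.forall_mem_insert.2 ⟨?_, fun δ' hδ' => ?_⟩⟩
    · exact and_left (hyp rfl)
    · have hφ : {and δ φ} ⊢ᵢ φ := and_right (hyp rfl)
      exact cut hφ ((hφΔ δ' hδ').mono (Set.singleton_subset_iff.2 (Set.mem_insert _ _)))

end Derives

open Derives

section Settles

variable {Γ : Set (Formula α)} {φ ψ : Formula α} {a b : Prop}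

/-- `Γ` settles `φ` as having the truth value `b`: it derives `φ` if `b` is true, and refutes `φ`
if `b` is false. -/
def Settles (Γ : Set (Formula α)) (b : Prop) (φ : Formula α) : Prop :=
  (b → Γ ⊢ᵢ φ) ∧ (¬b → Γ ⊢ᵢ φ.neg)

namespace Settles

theorem and (hφ : Settles Γ a φ) (hψ : Settles Γ b ψ) : Settles Γ (a ∧ b) (φ.and ψ) := by
  refine ⟨fun h => and_intro (hφ.1 h.1) (hψ.1 h.2), fun h => ?_⟩
  rcases not_and_or.1 h with ha | hb
  · exact deduction (mp (hφ.2 ha).weaken head.and_left)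
  · exact deduction (mp (hψ.2 hb).weaken head.and_right)

theorem or (hφ : Settles Γ a φ) (hψ : Settles Γ b ψ) : Settles Γ (a ∨ b) (φ.or ψ) := by
  refine ⟨fun h => h.elim (fun ha => (hφ.1 ha).or_inl) fun hb => (hψ.1 hb).or_inr, fun h => ?_⟩
  obtain ⟨ha, hb⟩ := not_or.1 h
  exact deduction (or_elim head (mp (hφ.2 ha).weaken.weaken head)
    (mp (hψ.2 hb).weaken.weaken head))

theorem imp (hφ : Settles Γ a φ) (hψ : Settles Γ b ψ) : Settles Γ (a → b) (φ.imp ψ) := by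
  refine ⟨fun h => ?_, fun h => ?_⟩
  · by_cases ha : a
    · exact (hψ.1 (h ha)).const
    · exact deduction (mp (hφ.2 ha).weaken head).bot_elim
  · obtain ⟨ha, hb⟩ := Classical.not_imp.1 h
    exact deduction (mp (hψ.2 hb).weaken (mp head (hφ.1 ha).weaken))

theorem subst {v : α → Prop} {σ : α → Formula α} {χ : Formula α}
    (hσ : ∀ x ∈ χ.vars, Settles Γ (v x) (σ x)) : Settles Γ (χ.Holds v) (χ.subst σ) := by
  induction χ with
  | var x => exact hσ x rfl
  | bot => exact ⟨False.elim, fun _ => imp_self⟩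
  | top => exact ⟨fun _ => top_intro, fun h => (h trivial).elim⟩
  | and _ _ ihφ ihψ => exact (ihφ fun x hx => hσ x (.inl hx)).and (ihψ fun x hx => hσ x (.inr hx))
  | or _ _ ihφ ihψ => exact (ihφ fun x hx => hσ x (.inl hx)).or (ihψ fun x hx => hσ x (.inr hx))
  | imp _ _ ihφ ihψ => exact (ihφ fun x hx => hσ x (.inl hx)).imp (ihψ fun x hx => hσ x (.inr hx))

end Settles

theorem derives_neg_of_forall_complete {s : Set α} (hs : s.Finite)
    (h : ∀ Γ', Γ ⊆ Γ' → (∀ x ∈ s, var x ∈ Γ' ∨ (var x).neg ∈ Γ') → Γ' ⊢ᵢ φ.neg) :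
    Γ ⊢ᵢ φ.neg := by
  induction s, hs using Set.Finite.induction_on generalizing Γ with
  | empty => exact h Γ subset_rfl fun _ hx => hx.elim
  | @insert a s _ _ ih =>
    refine neg_by_cases (var a) (ih fun Γ' hΓ' hs' => ?_) (ih fun Γ' hΓ' hs' => ?_) <;>
      obtain ⟨ha, hΓ⟩ := Set.insert_subset_iff.1 hΓ'
    · exact h Γ' hΓ (Set.forall_mem_insert.2 ⟨.inl ha, hs'⟩)
    · exact h Γ' hΓ (Set.forall_mem_insert.2 ⟨.inr ha, hs'⟩)

theorem derives_neg_of_forall_not_holds (hφ : ∀ v, ¬φ.Holds v) : Γ ⊢ᵢ φ.neg := by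
  refine derives_neg_of_forall_complete φ.finite_vars fun Γ' _ hvars => ?_
  have hsettles : Settles Γ' (φ.Holds fun x => var x ∈ Γ') (φ.subst var) :=
    Settles.subst fun x hx => ⟨hyp, fun hxΓ' => hyp ((hvars x hx).resolve_left hxΓ')⟩
  rw [subst_var] at hsettles
  exact hsettles.2 (hφ _)

end Settles

section Interderivable

variable {Γ : Set (Formula α)} {φ ψ χ φ' ψ' : Formula α}

/-- Equivalence of two formulas over a set of hypotheses. -/
def Interderivable (Γ : Set (Formula α)) (φ ψ : Formula α) : Prop :=
  insert φ Γ ⊢ᵢ ψ ∧ insert ψ Γ ⊢ᵢ φ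

namespace Interderivable

theorem refl (φ : Formula α) : Interderivable Γ φ φ := ⟨head, head⟩

theorem symm (h : Interderivable Γ φ ψ) : Interderivable Γ ψ φ := ⟨h.2, h.1⟩

theorem derives (h : Interderivable Γ φ ψ) (hφ : Γ ⊢ᵢ φ) : Γ ⊢ᵢ ψ := cut hφ h.1

theorem weaken (h : Interderivable Γ φ ψ) : Interderivable (insert χ Γ) φ ψ :=
  ⟨h.1.mono (Set.insert_subset_insert (Set.subset_insert _ _)),
    h.2.mono (Set.insert_subset_insert (Set.subset_insert _ _))⟩

theorem trans (h : Interderivable Γ φ ψ) (h' : Interderivable Γ ψ χ) : Interderivable Γ φ χ :=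
  ⟨h'.weaken.derives h.1, h.symm.weaken.derives h'.2⟩

theorem and_congr (h : Interderivable Γ φ φ') (h' : Interderivable Γ ψ ψ') :
    Interderivable Γ (and φ ψ) (and φ' ψ') :=
  ⟨and_intro (h.weaken.derives head.and_left) (h'.weaken.derives head.and_right),
    and_intro (h.symm.weaken.derives head.and_left) (h'.symm.weaken.derives head.and_right)⟩

theorem or_congr (h : Interderivable Γ φ φ') (h' : Interderivable Γ ψ ψ') :
    Interderivable Γ (or φ ψ) (or φ' ψ') :=
  ⟨or_elim head (h.weaken.weaken.derives head).or_inl (h'.weaken.weaken.derives head).or_inr,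
    or_elim head (h.symm.weaken.weaken.derives head).or_inl
      (h'.symm.weaken.weaken.derives head).or_inr⟩

theorem imp_congr (h : Interderivable Γ φ φ') (h' : Interderivable Γ ψ ψ') :
    Interderivable Γ (imp φ ψ) (imp φ' ψ') :=
  ⟨deduction (h'.weaken.weaken.derives (mp head.weaken (h.symm.weaken.weaken.derives head))),
    deduction (h'.symm.weaken.weaken.derives (mp head.weaken (h.weaken.weaken.derives head)))⟩

theorem subst_congr {σ τ : α → Formula α} {χ : Formula α}
    (h : ∀ x ∈ χ.vars, Interderivable Γ (σ x) (τ x)) :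
    Interderivable Γ (χ.subst σ) (χ.subst τ) := by
  induction χ with
  | var x => exact h x rfl
  | bot => exact .refl _
  | top => exact .refl _
  | and _ _ ihφ ihψ =>
    exact (ihφ fun x hx => h x (.inl hx)).and_congr (ihψ fun x hx => h x (.inr hx))
  | or _ _ ihφ ihψ =>
    exact (ihφ fun x hx => h x (.inl hx)).or_congr (ihψ fun x hx => h x (.inr hx))
  | imp _ _ ihφ ihψ =>
    exact (ihφ fun x hx => h x (.inl hx)).imp_congr (ihψ fun x hx => h x (.inr hx))

theorem imp_bot (hφ : Γ ⊢ᵢ φ.neg.neg) : Interderivable Γ bot (imp φ bot) :=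
  ⟨head.bot_elim, mp hφ.weaken head⟩

theorem imp_top : Interderivable Γ top (imp φ top) :=
  ⟨head.const, top_intro⟩

theorem imp_and : Interderivable Γ (and (imp φ ψ) (imp φ χ)) (imp φ (and ψ χ)) :=
  ⟨deduction (and_intro (mp head.weaken.and_left head) (mp head.weaken.and_right head)),
    and_intro (deduction (mp head.weaken head).and_left)
      (deduction (mp head.weaken head).and_right)⟩

theorem imp_imp : Interderivable Γ (imp (imp φ ψ) (imp φ χ)) (imp φ (imp ψ χ)) :=
  ⟨deduction (deduction (mp (mp head.weaken.weaken head.const) head.weaken)),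
    deduction (deduction (mp (mp head.weaken.weaken head) (mp head.weaken head)))⟩

end Interderivable

end Interderivable

/-- A set of hypotheses is linear if it derives all instances of the Gödel–Dummett axiom. -/
def IsLinear (Γ : Set (Formula α)) : Prop :=
  ∀ φ ψ, Γ ⊢ᵢ or (imp φ ψ) (imp ψ φ)

namespace IsLinear

variable {Γ : Set (Formula α)} {φ : Formula α}

theorem insert (hΓ : IsLinear Γ) : IsLinear (insert φ Γ) :=
  fun ψ χ => (hΓ ψ χ).weaken

theorem derives_neg_or_neg_neg (hΓ : IsLinear Γ) (φ : Formula α) : Γ ⊢ᵢ or φ.neg φ.neg.neg := by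
  refine or_elim (hΓ φ φ.neg) (or_inl (deduction ?_)) (or_inr (deduction ?_))
  · exact mp (mp head.weaken head) head
  · exact mp head (mp head.weaken head)

theorem imp_or (hΓ : IsLinear Γ) (φ ψ χ : Formula α) :
    Interderivable Γ (or (imp φ ψ) (imp φ χ)) (imp φ (or ψ χ)) := by
  refine ⟨deduction (or_elim head.weaken (mp head head.weaken).or_inl (mp head head.weaken).or_inr),
    or_elim (hΓ ψ χ).weaken (or_inr (deduction ?_)) (or_inl (deduction ?_))⟩
  · exact or_elim (mp head.weaken.weaken head) (mp head.weaken.weaken head) head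
  · exact or_elim (mp head.weaken.weaken head) head (mp head.weaken.weaken head)

theorem subst_interderivable_imp (hΓ : IsLinear Γ) (hφ : Γ ⊢ᵢ φ.neg.neg) {σ : α → Formula α}
    {χ : Formula α} (hσ : ∀ x ∈ χ.vars, Interderivable Γ (σ x) (imp φ (var x))) :
    Interderivable Γ (χ.subst σ) (imp φ χ) := by
  induction χ with
  | var x => exact hσ x rfl
  | bot => exact .imp_bot hφ
  | top => exact .imp_top
  | and _ _ ihψ ihχ =>
    exact ((ihψ fun x hx => hσ x (.inl hx)).and_congr (ihχ fun x hx => hσ x (.inr hx))).trans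
      .imp_and
  | or ψ χ ihψ ihχ =>
    exact ((ihψ fun x hx => hσ x (.inl hx)).or_congr (ihχ fun x hx => hσ x (.inr hx))).trans
      (hΓ.imp_or φ ψ χ)
  | imp _ _ ihψ ihχ =>
    exact ((ihψ fun x hx => hσ x (.inl hx)).imp_congr (ihχ fun x hx => hσ x (.inr hx))).trans
      .imp_imp

end IsLinear

section Projective

variable {Γ : Set (Formula α)} {φ : Formula α} {v : α → Prop}

/-- Projective unifiers, in the sense of Ghilardi, over the logic with theorems `Γ`: `σ` makes `φ` a
theorem, and `φ` entails that `σ` fixes every formula up to equivalence. It suffices to require the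
latter of the variables. -/
structure IsProjectiveUnifier (Γ : Set (Formula α)) (σ : α → Formula α) (φ : Formula α) :
    Prop where
  derives_subst : Γ ⊢ᵢ φ.subst σ
  interderivable_var : ∀ x, Interderivable (insert φ Γ) (σ x) (var x)

theorem IsProjectiveUnifier.interderivable {σ : α → Formula α} (hσ : IsProjectiveUnifier Γ σ φ)
    (χ : Formula α) : Interderivable (insert φ Γ) (χ.subst σ) χ := by
  simpa only [subst_var] using
    Interderivable.subst_congr (χ := χ) (τ := var) fun x _ => hσ.interderivable_var x

open Classical in
/-- The substitution that is a projective unifier of `φ` over linear logics if `v` satisfies `φ`. -/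
noncomputable def unifier (φ : Formula α) (v : α → Prop) (x : α) : Formula α :=
  if v x then imp φ (var x) else and φ.neg.neg (imp φ (var x))

theorem unifier_interderivable_imp (hφ : Γ ⊢ᵢ φ.neg.neg) (x : α) :
    Interderivable Γ (unifier φ v x) (imp φ (var x)) := by
  unfold unifier
  split_ifs
  · exact .refl _
  · exact ⟨head.and_right, and_intro hφ.weaken head⟩

theorem unifier_interderivable_var (hφ : Γ ⊢ᵢ φ) (x : α) :
    Interderivable Γ (unifier φ v x) (var x) :=
  (unifier_interderivable_imp (deduction (mp head hφ.weaken)) x).trans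
    ⟨mp head hφ.weaken, head.const⟩

theorem settles_unifier (hφ : Γ ⊢ᵢ φ.neg) (x : α) : Settles Γ (v x) (unifier φ v x) := by
  refine ⟨fun hx => ?_, fun hx => ?_⟩
  · rw [unifier, if_pos hx]
    exact deduction (mp hφ.weaken head).bot_elim
  · rw [unifier, if_neg hx]
    exact deduction (mp head.and_left hφ.weaken)

theorem isProjectiveUnifier_unifier (hΓ : IsLinear Γ) (hφ : φ.Holds v) :
    IsProjectiveUnifier Γ (unifier φ v) φ where
  derives_subst := by
    refine or_elim (hΓ.derives_neg_or_neg_neg φ) ?_ ?_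
    · exact (Settles.subst fun x _ => settles_unifier head x).1 hφ
    · have hequiv := hΓ.insert.subst_interderivable_imp (χ := φ) (head (φ := φ.neg.neg))
        fun x _ => unifier_interderivable_imp (v := v) head x
      exact hequiv.symm.derives imp_self
  interderivable_var := unifier_interderivable_var head

end Projective

section StructuralCompleteness

variable {S : Set (Rule α)}

/-- Structural completeness of a set of `Π₂`-rules: it contains each `Π₁`-rule all of whose
substitution instances preserve its theorems. -/
def IsStructurallyComplete (S : Set (Rule α)) : Prop :=
  ∀ (Δ : Set (Formula α)) (hΔ : Δ.Finite) (ψ : Formula α),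
    (∀ σ : α → Formula α, (∀ δ ∈ Δ, Rule.thm (δ.subst σ) ∈ S) → Rule.thm (ψ.subst σ) ∈ S) →
      Rule.pi1 Δ hΔ ψ ∈ S

theorem IsRuleSystem.isStructurallyComplete (hS : IsRuleSystem S) (hIPC : IPC ⊆ S)
    (hlin : IsLinear (theorems S)) : IsStructurallyComplete S := by
  intro Δ hΔ ψ hψ
  obtain ⟨φ, hΔφ, hφΔ⟩ := exists_conjunction hΔ
  have hφ : Δ ∪ theorems S ⊢ᵢ φ := hΔφ.mono Set.subset_union_left
  refine Derives.pi1_mem hS hIPC hΔ ?_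
  by_cases hsat : ∃ v, φ.Holds v
  · obtain ⟨v, hv⟩ := hsat
    have hunif := isProjectiveUnifier_unifier hlin hv
    have hφσ : Rule.thm (φ.subst (unifier φ v)) ∈ S :=
      Derives.pi1_mem hS hIPC Set.finite_empty (hunif.derives_subst.mono Set.subset_union_right)
    have hδσ : ∀ δ ∈ Δ, Rule.thm (δ.subst (unifier φ v)) ∈ S := by
      intro δ hδ
      have hφδ : Rule.pi1 {φ} (Set.finite_singleton φ) δ ∈ S :=
        Derives.pi1_mem hS hIPC _ ((hφΔ δ hδ).mono Set.subset_union_left)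
      exact hS.thm_subst_mem hφδ fun _ hφ' => hφ' ▸ hφσ
    have hψ_of_φ : insert φ (theorems S) ⊢ᵢ ψ :=
      (hunif.interderivable ψ).derives (hyp (.inr (hψ _ hδσ)))
    exact cut hφ (hψ_of_φ.mono (Set.insert_subset_insert Set.subset_union_right))
  · exact (mp (derives_neg_of_forall_not_holds (not_exists.1 hsat)) hφ).bot_elim

theorem HereditarilyAdmissible.admissible {ρ : Rule α} (h : HereditarilyAdmissible S ρ) :
    Admissible S ρ :=
  fun χ hχ => h ∅ Set.finite_empty χ hχ

theorem IsStructurallyComplete.hereditarilyAdmissible (hS : IsStructurallyComplete S) {ρ : Rule α}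
    (h : Admissible S ρ) : HereditarilyAdmissible S ρ :=
  fun Δ hΔ ψ hψ => hS Δ hΔ ψ fun _ hσ => h _ <|
    (isRuleSystem_oplus S {ρ}).thm_subst_mem hψ fun δ hδ => subset_oplus_left _ _ (hσ δ hδ)

end StructuralCompleteness

end PiTwo

open PiTwo in
theorem mainTheorem6_general {α : Type*} [Nontrivial α] {S : Set (Rule α)} (hS : IsRuleSystem S)
    (hLC : LC ⊆ S) (ρ : Rule α) : Admissible S ρ ↔ HereditarilyAdmissible S ρ := by
  have hlin : IsLinear (theorems S) := fun φ ψ => .hyp (hS.thm_linearity_mem hLC φ ψ)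
  have hcomplete : IsStructurallyComplete S :=
    hS.isStructurallyComplete (IPC_subset_LC.trans hLC) hlin
  exact ⟨hcomplete.hereditarilyAdmissible, HereditarilyAdmissible.admissible⟩

theorem mainTheorem6 {α : Type*} [Infinite α] (ρ : PiTwo.Rule α) :
    PiTwo.Admissible PiTwo.LC ρ ↔ PiTwo.HereditarilyAdmissible PiTwo.LC ρ :=
  mainTheorem6_general (PiTwo.isRuleSystem_oplus _ _) subset_rfl ρ
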